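/- **Model.** The input graph $G=(V,E)$ on $n$ nodes is also the communication network. The nodes carry distinct identifiers from $\{0,\dots,N-1\}$, where $N\le n^{c}$ for a constant $c$ of the model; every node initially knows $N$, its own identifier and its degree, and the edges at each node are numbered by ports in an arbitrary way. Computation proceeds in synchronous rounds; in each round every node may send to each neighbour a (possibly different) message of at most $b\lceil\log_2 n\rceil$ bits, $b$ a constant (the $\mathsf{CONGEST}$ model). Local computation is free and deterministic. An algorithm *detects induced copies of $T$* if eventually every node irrevocably outputs yes or no, every node that belongs to an induced copy of $T$ in $G$ outputs yes, and no node outputs yes if $G$ has no induced copy of $T$. A graph is *$d$-degenerate* if every nonempty induced subgraph has a vertex of degree at most $d$. **Theorem.** There is a function $f\colon\mathbb N\times\mathbb N\to\mathbb N$ such that for every constant $c$ there are constants $b,C$ with the following property. For all $d,k\in\mathbb N$ and every tree $T$ on $k$ nodes there is a deterministic algorithm in the $\mathsf{CONGEST}$ model with messages of at most $b\lceil\log_2 n\rceil$ bits (the algorithm may depend on $c$, $d$ and $T$, i.e. all nodes know $c$, $d$ and $T$) that, on every $d$-degenerate graph $G$ on $n$ nodes, for every $N\le n^{c}$, every assignment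 of distinct identifiers from $\{0,\dots,N-1\}$ and every port numbering, detects induced copies of $T$ within $$f(d,k)+C\lceil\log_2 n\rceil = f(d,k)+O(\log n)$$ rounds. -/

import Mathlib

/-- A finite graph is `d`-degenerate if every nonempty induced subgraph `G[S]` has a vertex of
degree at most `d`. -/
def SimpleGraph.IsDegenerate {V : Type*} (G : SimpleGraph V) (d : ℕ) : Prop :=
  ∀ S : Set V, S.Nonempty → ∃ v ∈ S, (G.neighborSet v ∩ S).ncard ≤ d

namespace Congest

/-- A deterministic synchronous message-passing algorithm with Boolean outputs. Local computation
is free, so the local transitions are arbitrary functions.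

* `init N i δ` is the initial state of a node with identifier `i` and degree `δ`; the number `N`
  is known to all nodes.
* `send δ s p` is the bit string that a node of degree `δ` in state `s` sends through its port `p`.
* `recv δ s m` is its next state when it receives the bit string `m p` through each port `p`.
* `out s` is the output fixed so far, if any; an output is never revoked. -/
structure Algorithm where
  State : Type
  init : (N : ℕ) → Fin N → ℕ → State
  send : (δ : ℕ) → State → Fin δ → List Bool
  recv : (δ : ℕ) → State → (Fin δ → List Bool) → State
  out : State → Option Bool
  out_recv : ∀ (δ : ℕ) (s : State) (m : Fin δ → List Bool) (y : Bool),
    out s = some y → out (recv δ s m) = some y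

/-- A network on the communication graph `G`: the nodes carry distinct identifiers from a range of
size `N`, and the edges at each node are numbered by ports, in an arbitrary way. (The bijection
`port v` forces `deg v` to be the degree of `v`.) -/
structure Network {V : Type*} (G : SimpleGraph V) (N : ℕ) where
  ident : V ↪ Fin N
  deg : V → ℕ
  port : (v : V) → Fin (deg v) ≃ G.neighborSet v

namespace Network

variable {V : Type*} {G : SimpleGraph V} {N : ℕ}

/-- The neighbour of `v` behind port `p`. -/
def nbr (net : Network G N) (v : V) (p : Fin (net.deg v)) : V :=
  (net.port v p : V)

/-- The port of that neighbour which leads back to `v`. -/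
def back (net : Network G N) (v : V) (p : Fin (net.deg v)) : Fin (net.deg (net.nbr v p)) :=
  (net.port (net.nbr v p)).symm ⟨v, SimpleGraph.Adj.symm (net.port v p).2⟩

/-- The state of each node after `t` synchronous rounds. -/
def state (net : Network G N) (A : Algorithm) : ℕ → V → A.State
  | 0, v => A.init N (net.ident v) (net.deg v)
  | t + 1, v => A.recv (net.deg v) (state net A t v) fun p =>
      A.send (net.deg (net.nbr v p)) (state net A t (net.nbr v p)) (net.back v p)

/-- The message sent by `v` through port `p` in round `t + 1`. -/
def message (net : Network G N) (A : Algorithm) (t : ℕ) (v : V) (p : Fin (net.deg v)) :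
    List Bool :=
  A.send (net.deg v) (net.state A t v) p

end Network

/-- On the given network, with messages of at most `B` bits, the algorithm `A` terminates
within `R` rounds: by then every node has fixed an output. Moreover the outputs solve
induced `H`-detection: every node that belongs to an induced copy of `H` reports "yes", and no node
reports "yes" if there is no induced copy of `H`. -/
def DetectsInduced {V W : Type*} {G : SimpleGraph V} {N : ℕ} (A : Algorithm) (net : Network G N)
    (H : SimpleGraph W) (B R : ℕ) : Prop :=
  (∀ t < R, ∀ v p, (net.message A t v p).length ≤ B) ∧
  ∃ y : V → Bool, (∀ v, A.out (net.state A R v) = some (y v)) ∧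
    (∀ v, (∃ φ : H ↪g G, v ∈ Set.range φ) → y v = true) ∧
    ((∃ v, y v = true) → Nonempty (H ↪g G))

end Congest

/-!
A `d`-degenerate graph has average degree at most `2 * d`, so removing all vertices of degree at
most `4 * d` at least halves the vertex set. Hence `O(log n)` rounds of peeling orient the edges
with out-degree at most `4 * d`.

Fix an induced copy of the tree `T` on `k` nodes. It is found by a partial colouring of the nodes
with the nodes of `T` that is right on the copy and leaves all other out-neighbours of the copy
uncoloured. This prescribes only `k * (4 * d + 1)` values. A random colouring has these values with
a probability that depends only on `d` and `k`, and there are polynomially many possible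
prescriptions, so some explicit family of `O(log n)` colourings, known to all nodes, contains a
suitable one for every copy.

For a given colouring, each node can test that its out-neighbours have colours adjacent to its own;
since every edge is an out-edge of one of its ends, a homomorphism from `T` that respects the
colours of tested nodes is an induced copy. As `T` is a tree, such a homomorphism starts at every
node that survives `k` rounds of arc consistency. One message carries the survival bits of
`log n + 1` colourings at once, so the number of rounds for all colourings is bounded in terms of
`d` and `k`.
-/

namespace Congest

section UniversalFamily

variable {ι κ α β Ω : Type*}

theorem exists_subset_range_of_card_le [Fintype ι] [Nonempty α] {s : Finset α}
    (hs : s.card ≤ Fintype.card ι) : ∃ f : ι → α, ↑s ⊆ Set.range f := by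
  obtain ⟨e⟩ := Function.Embedding.nonempty_of_card_le (α := s) (by simpa using hs)
  exact ⟨Function.extend e Subtype.val fun _ => Classical.arbitrary α,
    fun x hx => ⟨e ⟨x, hx⟩, e.injective.extend_apply _ _ _⟩⟩

section GreedyCover

variable [Fintype Ω] [Nonempty Ω] {r : κ → Ω → Prop} [∀ p, DecidablePred (r p)] {ε : ℝ}

theorem exists_mul_card_le_card_filter
    (hr : ∀ p, ε * Fintype.card Ω ≤ (Finset.univ.filter (r p)).card) (Q : Finset κ) :
    ∃ ω, ε * Q.card ≤ (Q.filter (r · ω)).card := by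
  by_contra! h
  have hlt := Finset.card_nsmul_lt_card_nsmul_of_le_of_lt r (s := Q) Finset.univ_nonempty
    (fun p _ => hr p) fun ω _ => h ω
  rw [nsmul_eq_mul, nsmul_eq_mul, Finset.card_univ] at hlt
  linarith

open scoped Classical in
theorem exists_card_le_card_filter_forall_not_le [Fintype κ]
    (hr : ∀ p, ε * Fintype.card Ω ≤ (Finset.univ.filter (r p)).card) (t : ℕ) :
    ∃ s : Finset Ω, s.card ≤ t ∧
      ((Finset.univ.filter fun p => ∀ ω ∈ s, ¬ r p ω).card : ℝ) ≤
        Real.exp (-(ε * t)) * Fintype.card κ := by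
  induction t with
  | zero => exact ⟨∅, by simp⟩
  | succ t ih =>
    obtain ⟨s, hst, hs⟩ := ih
    set Q := Finset.univ.filter fun p => ∀ ω ∈ s, ¬ r p ω with hQ
    obtain ⟨ω, hω⟩ := exists_mul_card_le_card_filter hr Q
    refine ⟨insert ω s, (Finset.card_insert_le _ _).trans (by lia), ?_⟩
    have hsplit : ((Q.filter (r · ω)).card : ℝ) + (Q.filter (¬ r · ω)).card = Q.card :=
      mod_cast Finset.card_filter_add_card_filter_not _
    have hinsert : (Finset.univ.filter fun p => ∀ ω' ∈ insert ω s, ¬ r p ω') =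
        Q.filter (¬ r · ω) := by
      ext p
      simp [hQ, and_comm]
    calc ((Finset.univ.filter fun p => ∀ ω' ∈ insert ω s, ¬ r p ω').card : ℝ)
        ≤ (1 - ε) * Q.card := by rw [hinsert]; linarith
      _ ≤ Real.exp (-ε) * (Real.exp (-(ε * t)) * Fintype.card κ) := by
        gcongr
        exact Real.one_sub_le_exp_neg ε
      _ = Real.exp (-(ε * (t + 1 : ℕ))) * Fintype.card κ := by
        rw [← mul_assoc, ← Real.exp_add]
        push_cast
        ring_nf

open scoped Classical in
theorem exists_card_le_forall_exists [Fintype κ] {t : ℕ}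
    (hr : ∀ p, ε * Fintype.card Ω ≤ (Finset.univ.filter (r p)).card)
    (ht : Fintype.card κ < Real.exp (ε * t)) :
    ∃ s : Finset Ω, s.card ≤ t ∧ ∀ p, ∃ ω ∈ s, r p ω := by
  obtain ⟨s, hst, hs⟩ := exists_card_le_card_filter_forall_not_le hr t
  refine ⟨s, hst, fun p => ?_⟩
  have hlt : Real.exp (-(ε * t)) * Fintype.card κ < 1 := by
    rwa [Real.exp_neg, inv_mul_lt_one₀ (Real.exp_pos _)]
  have hempty : (Finset.univ.filter fun p => ∀ ω ∈ s, ¬ r p ω).card = 0 := by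
    exact_mod_cast Nat.lt_one_iff.mp (mod_cast hs.trans_lt hlt)
  by_contra! hp
  exact Finset.filter_eq_empty_iff.mp (Finset.card_eq_zero.mp hempty) (Finset.mem_univ p) hp

end GreedyCover

/-- A family of functions is `m`-universal if its members realise all restrictions of functions to
at most `m` points. The points are listed, possibly with repetitions, by `x`. -/
def IsUniversal (F : ι → α → β) (m : ℕ) : Prop :=
  ∀ (χ : α → β) (x : Fin m → α), ∃ i, ∀ q, F i (x q) = χ (x q)

theorem IsUniversal.comp_injective [Nonempty β] {F : ι → α → β} {m : ℕ} (hF : IsUniversal F m)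
    {e : κ → α} (he : Function.Injective e) : IsUniversal (fun i => F i ∘ e) m := by
  intro χ x
  obtain ⟨i, hi⟩ := hF (Function.extend e χ fun _ => Classical.arbitrary β) (e ∘ x)
  exact ⟨i, fun q => (hi q).trans (he.extend_apply _ _ _)⟩

theorem IsUniversal.exists_eqOn [Finite α] [Nonempty α] {F : ι → α → β} {m : ℕ}
    (hF : IsUniversal F m) (χ : α → β) {S : Set α} (hS : S.ncard ≤ m) :
    ∃ i, Set.EqOn (F i) χ S := by
  obtain ⟨x, hx⟩ := exists_subset_range_of_card_le (ι := Fin m) (s := S.toFinite.toFinset) <| by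
    rwa [← Set.ncard_eq_toFinset_card, Fintype.card_fin]
  obtain ⟨i, hi⟩ := hF χ x
  refine ⟨i, fun y hy => ?_⟩
  obtain ⟨q, rfl⟩ := hx (S.toFinite.mem_toFinset.mpr hy)
  exact hi q

variable [Fintype α] [Fintype β]

open scoped Classical in
theorem card_fun_le_mul_card_filter_eq {m : ℕ} (χ₀ : α → β) (x : Fin m → α) :
    Fintype.card (α → β) ≤ Fintype.card β ^ m *
      (Finset.univ.filter fun χ : α → β => ∀ q, χ (x q) = χ₀ (x q)).card := by
  let split : (α → β) → (Fin m → β) × {χ : α → β // ∀ q, χ (x q) = χ₀ (x q)} := fun χ =>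
    (χ ∘ x, ⟨(Set.range x).piecewise χ₀ χ, fun q =>
      Set.piecewise_eq_of_mem _ _ _ (Set.mem_range_self q)⟩)
  have hsplit : split.Injective := fun χ χ' h => by
    obtain ⟨hon, hoff⟩ := Prod.mk.inj h
    funext y
    by_cases hy : y ∈ Set.range x
    · obtain ⟨q, rfl⟩ := hy
      exact congrFun hon q
    · simpa [hy] using congrFun (Subtype.mk.inj hoff) y
  simpa [← Fintype.card_subtype] using Fintype.card_le_of_injective split hsplit

theorem mul_pow_lt_exp {a L : ℕ} (ha : a ≤ 2 ^ L) (q m : ℕ) :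
    ((a * q : ℕ) : ℝ) ^ m < Real.exp (m * (L + q) + 1) := by
  have haL : (a : ℝ) ≤ Real.exp L := calc
    (a : ℝ) ≤ 2 ^ L := mod_cast ha
    _ ≤ Real.exp 1 ^ L := by gcongr; linarith [Real.add_one_le_exp 1]
    _ = Real.exp L := by rw [← Real.exp_nat_mul, mul_one]
  calc ((a * q : ℕ) : ℝ) ^ m ≤ (Real.exp L * Real.exp q) ^ m := by
        push_cast
        gcongr
        linarith [Real.add_one_le_exp (q : ℝ)]
    _ = Real.exp (m * (L + q)) := by rw [← Real.exp_add, ← Real.exp_nat_mul]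
    _ < Real.exp (m * (L + q) + 1) := Real.exp_lt_exp.mpr (lt_add_one _)

theorem exists_isUniversal [Fintype ι] [Nonempty β] {L m : ℕ} (hα : Fintype.card α ≤ 2 ^ L)
    (hι : Fintype.card β ^ m * (m * (L + Fintype.card β) + 1) ≤ Fintype.card ι) :
    ∃ F : ι → α → β, IsUniversal F m := by
  classical
  let Pattern := {p : Fin m → α × β // ∃ χ : α → β, ∀ i, χ (p i).1 = (p i).2}
  have hdense (p : Pattern) : ((Fintype.card β : ℝ) ^ m)⁻¹ * Fintype.card (α → β) ≤
      (Finset.univ.filter fun χ : α → β => ∀ i, χ (p.1 i).1 = (p.1 i).2).card := by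
    obtain ⟨p, χ₀, hχ₀⟩ := p
    rw [inv_mul_le_iff₀ (by positivity)]
    have hcard := card_fun_le_mul_card_filter_eq χ₀ fun i => (p i).1
    simp only [hχ₀] at hcard
    exact_mod_cast hcard
  have hpatterns : Fintype.card Pattern ≤ (Fintype.card α * Fintype.card β) ^ m :=
    (Fintype.card_subtype_le _).trans_eq (by simp)
  obtain ⟨t, ht⟩ : ∃ t, t = Fintype.card β ^ m * (m * (L + Fintype.card β) + 1) := ⟨_, rfl⟩
  have hexp : (Fintype.card Pattern : ℝ) < Real.exp (((Fintype.card β : ℝ) ^ m)⁻¹ * t) := calc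
    (Fintype.card Pattern : ℝ) ≤ ((Fintype.card α * Fintype.card β : ℕ) : ℝ) ^ m :=
      mod_cast hpatterns
    _ < Real.exp (m * (L + Fintype.card β) + 1) := mul_pow_lt_exp hα _ _
    _ = Real.exp (((Fintype.card β : ℝ) ^ m)⁻¹ * t) := by
      rw [ht]
      push_cast
      rw [inv_mul_cancel_left₀ (by positivity)]
  obtain ⟨s, hs, hcover⟩ := exists_card_le_forall_exists hdense hexp
  obtain ⟨F, hF⟩ := exists_subset_range_of_card_le (hs.trans (ht.trans_le hι))
  refine ⟨F, fun χ x => ?_⟩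
  obtain ⟨ω, hω, hpass⟩ := hcover ⟨fun i => (x i, χ (x i)), χ, fun _ => rfl⟩
  obtain ⟨i, rfl⟩ := hF hω
  exact ⟨i, hpass⟩

theorem exists_isUniversal_prod [Nonempty β] {L q : ℕ} (hα : Fintype.card α ≤ 2 ^ L)
    (hβ : Fintype.card β = q) (m : ℕ) :
    ∃ F : Fin (q ^ m * (m * q + 1)) × Fin (L + 1) → α → β, IsUniversal F m := by
  subst hβ
  refine exists_isUniversal hα ?_
  have hpos : 1 ≤ Fintype.card β := Fintype.card_pos
  rw [Fintype.card_prod, Fintype.card_fin, Fintype.card_fin, mul_assoc]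
  gcongr
  nlinarith [Nat.mul_le_mul_left (m * L) hpos]

end UniversalFamily

section Degenerate

variable {V : Type*} {G : SimpleGraph V} {d : ℕ}

open scoped Classical in
theorem ncard_neighborSet_inter_insert_le (S : Finset V) (v w : V) :
    (G.neighborSet w ∩ ↑(insert v S)).ncard ≤
      (G.neighborSet w ∩ S).ncard + if G.Adj v w then 1 else 0 := by
  rw [Finset.coe_insert]
  by_cases h : G.Adj v w
  · rw [if_pos h, Set.inter_insert_of_mem (G.mem_neighborSet w v |>.mpr h.symm)]
    exact Set.ncard_insert_le _ _
  · rw [if_neg h, Set.inter_insert_of_notMem fun hv => h (G.mem_neighborSet w v |>.mp hv).symm,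
      add_zero]

theorem sum_ncard_neighborSet_inter_le (hG : G.IsDegenerate d) (S : Finset V) :
    ∑ v ∈ S, (G.neighborSet v ∩ S).ncard ≤ 2 * d * S.card := by
  classical
  induction S using Finset.strongInduction with
  | H S ih =>
    rcases S.eq_empty_or_nonempty with rfl | hne
    · simp
    obtain ⟨v, hv, hvd⟩ := hG S (by simpa using hne)
    obtain ⟨S', hvS', rfl⟩ : ∃ S', v ∉ S' ∧ insert v S' = S :=
      ⟨S.erase v, Finset.notMem_erase v S, Finset.insert_erase hv⟩
    have hadj : ∑ w ∈ S', (if G.Adj v w then 1 else 0) ≤ d := by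
      rw [← Finset.card_filter, ← Set.ncard_coe_finset]
      refine (Set.ncard_le_ncard (fun w hw => ?_)
        ((Finset.finite_toSet _).inter_of_right _)).trans hvd
      simp_all
    have hrest : ∑ w ∈ S', (G.neighborSet w ∩ ↑(insert v S')).ncard ≤ 2 * d * S'.card + d := calc
      _ ≤ ∑ w ∈ S', ((G.neighborSet w ∩ S').ncard + if G.Adj v w then 1 else 0) :=
        Finset.sum_le_sum fun w _ => ncard_neighborSet_inter_insert_le S' v w
      _ ≤ 2 * d * S'.card + d := by
        rw [Finset.sum_add_distrib]
        exact add_le_add (ih S' (Finset.ssubset_insert hvS')) hadj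
    rw [Finset.sum_insert hvS', Finset.card_insert_of_notMem hvS']
    linarith

/-- The vertices that remain after `t` rounds of simultaneously removing all vertices that have at
most `D` remaining neighbours. -/
def peel (G : SimpleGraph V) (D : ℕ) : ℕ → Set V
  | 0 => Set.univ
  | t + 1 => {v | v ∈ peel G D t ∧ D < (G.neighborSet v ∩ peel G D t).ncard}

theorem peel_antitone (G : SimpleGraph V) (D : ℕ) : Antitone (peel G D) :=
  antitone_nat_of_succ_le fun _ _ hv => hv.1

theorem mul_ncard_peel_succ_le [Finite V] (hG : G.IsDegenerate d) (D t : ℕ) :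
    (D + 1) * (peel G D (t + 1)).ncard ≤ 2 * d * (peel G D t).ncard := by
  classical
  have := Fintype.ofFinite V
  set S := (peel G D t).toFinset
  set S' := (peel G D (t + 1)).toFinset
  have hS : (S : Set V) = peel G D t := Set.coe_toFinset _
  have hsub : S' ⊆ S := Set.toFinset_subset_toFinset.mpr (peel_antitone G D t.le_succ)
  rw [Set.ncard_eq_toFinset_card', Set.ncard_eq_toFinset_card', mul_comm]
  calc S'.card * (D + 1) ≤ ∑ v ∈ S', (G.neighborSet v ∩ S).ncard := by
        rw [← smul_eq_mul]
        refine Finset.card_nsmul_le_sum _ _ _ fun v hv => ?_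
        rw [hS]
        exact (Set.mem_toFinset.mp hv).2
    _ ≤ ∑ v ∈ S, (G.neighborSet v ∩ S).ncard := Finset.sum_le_sum_of_subset hsub
    _ ≤ 2 * d * S.card := sum_ncard_neighborSet_inter_le hG S

theorem two_pow_mul_ncard_peel_le [Finite V] (hG : G.IsDegenerate d) (t : ℕ) :
    2 ^ t * (peel G (4 * d) t).ncard ≤ Nat.card V := by
  induction t with
  | zero => simp [peel]
  | succ t ih =>
    have hhalf : 2 * (peel G (4 * d) (t + 1)).ncard ≤ (peel G (4 * d) t).ncard := by
      have := mul_ncard_peel_succ_le hG (4 * d) t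
      by_contra! h
      nlinarith
    calc 2 ^ (t + 1) * (peel G (4 * d) (t + 1)).ncard
        = 2 ^ t * (2 * (peel G (4 * d) (t + 1)).ncard) := by ring
      _ ≤ 2 ^ t * (peel G (4 * d) t).ncard := by gcongr
      _ ≤ Nat.card V := ih

theorem peel_eq_empty [Finite V] (hG : G.IsDegenerate d) {t : ℕ} (ht : Nat.card V < 2 ^ t) :
    peel G (4 * d) t = ∅ := by
  rw [← Set.ncard_eq_zero, ← Nat.lt_one_iff]
  exact lt_of_mul_lt_mul_left ((two_pow_mul_ncard_peel_le hG t).trans_lt (by simpa)) (by positivity)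

/-- The neighbours of `v` that were not removed before `v` in the first `t` rounds of peeling.
Orienting each edge towards the end that is removed later (and both ways in case of a tie), these
are the out-neighbours of `v`. -/
def outNbrs (G : SimpleGraph V) (D t : ℕ) (v : V) : Set V :=
  {w | G.Adj v w ∧ ∀ s < t, v ∈ peel G D s → w ∈ peel G D s}

theorem outNbrs_subset (D t : ℕ) (v : V) : outNbrs G D t v ⊆ G.neighborSet v :=
  fun _ hw => hw.1

theorem neighborSet_diff_outNbrs_succ (G : SimpleGraph V) (D t : ℕ) (v : V) :
    G.neighborSet v \ outNbrs G D (t + 1) v = G.neighborSet v \ outNbrs G D t v ∪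
      {w | v ∈ peel G D t ∧ G.Adj v w ∧ w ∉ peel G D t} := by
  ext w
  simp only [outNbrs, Nat.forall_lt_succ_right, Set.mem_sdiff, Set.mem_union,
    SimpleGraph.mem_neighborSet, Set.mem_ofPred_eq]
  tauto

theorem ncard_outNbrs_le [Finite V] {D t : ℕ} {v : V} (hv : v ∉ peel G D t) :
    (outNbrs G D t v).ncard ≤ D := by
  obtain ⟨s, hst, hs, hs'⟩ : ∃ s < t, v ∈ peel G D s ∧ v ∉ peel G D (s + 1) := by
    induction t with
    | zero => exact absurd (Set.mem_univ v) hv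
    | succ t ih =>
      by_cases hvt : v ∈ peel G D t
      · exact ⟨t, t.lt_succ_self, hvt, hv⟩
      · obtain ⟨s, hst, hs⟩ := ih hvt
        exact ⟨s, hst.trans t.lt_succ_self, hs⟩
  calc (outNbrs G D t v).ncard ≤ (G.neighborSet v ∩ peel G D s).ncard :=
        Set.ncard_le_ncard fun w hw => ⟨hw.1, hw.2 s hst hs⟩
    _ ≤ D := not_lt.mp fun h => hs' ⟨hs, h⟩

theorem mem_outNbrs_or_mem_outNbrs (D t : ℕ) {u v : V} (huv : G.Adj u v) :
    v ∈ outNbrs G D t u ∨ u ∈ outNbrs G D t v := by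
  by_contra! h
  simp only [outNbrs, Set.mem_ofPred_eq, huv, huv.symm, true_and, not_forall] at h
  obtain ⟨⟨s, -, hus, hvs⟩, ⟨s', -, hvs', hus'⟩⟩ := h
  rcases le_total s s' with hle | hle
  · exact hvs (peel_antitone G D hle hvs')
  · exact hus' (peel_antitone G D hle hus)

end Degenerate

section TreeHom

variable {V W : Type*} {G : SimpleGraph V} {T : SimpleGraph W}

theorem exists_adj_dist_eq_add_one (hT : T.Connected) {r j : W} (hrj : r ≠ j) :
    ∃ i, T.Adj i j ∧ T.dist r j = T.dist r i + 1 := by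
  obtain ⟨p, hp⟩ := hT.exists_walk_length_eq_dist j r
  cases p with
  | nil => exact absurd rfl hrj
  | @cons _ i _ h p =>
    refine ⟨i, h.symm, ?_⟩
    have hle : T.dist i r ≤ p.length := SimpleGraph.dist_le p
    have hdiff := h.diff_dist_adj (u := r)
    rw [SimpleGraph.Walk.length_cons] at hp
    rw [T.dist_comm (u := j)] at hp
    rw [T.dist_comm (u := i)] at hle
    lia

theorem exists_parent (hT : T.IsTree) (r : W) :
    ∃ parent : W → W, ∀ i j, T.Adj i j → T.dist r j = T.dist r i + 1 → parent j = i := by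
  choose p _ huniq using fun j => hT.existsUnique_path r j
  refine ⟨fun j => (p j).penultimate, fun i j hij hdist => show (p j).penultimate = i from ?_⟩
  obtain ⟨q, hq⟩ := hT.connected.exists_walk_length_eq_dist r i
  have hpath : (q.concat hij).IsPath := SimpleGraph.Walk.isPath_of_length_eq_dist _ <| by
    rw [SimpleGraph.Walk.length_concat, hq, hdist]
  rw [← huniq j _ hpath, SimpleGraph.Walk.penultimate_concat]

theorem exists_tree_recursion (hT : T.IsTree) (r : W) (v₀ : V) (step : W → W → V → V) :
    ∃ φ : W → V, φ r = v₀ ∧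
      ∀ i j, T.Adj i j → T.dist r j = T.dist r i + 1 → φ j = step i j (φ i) := by
  obtain ⟨parent, hparent⟩ := exists_parent hT r
  let ψ : ℕ → W → V :=
    Nat.rec (fun _ => v₀) fun _ ψ j => step (parent j) j (ψ (parent j))
  refine ⟨fun j => ψ (T.dist r j) j, by simp [ψ], fun i j hij hdist => ?_⟩
  simp only [ψ, hdist, hparent i j hij hdist]

theorem exists_hom_of_extends (hT : T.IsTree) {P : W → V → Prop} {r : W} {v₀ : V} (hr : P r v₀)
    (hP : ∀ i j v, T.Adj i j → T.dist r j = T.dist r i + 1 → P i v → ∃ w, G.Adj v w ∧ P j w) :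
    ∃ φ : T →g G, ∀ i, P i (φ i) := by
  have hstep (i j : W) (v : V) : ∃ w, T.Adj i j → T.dist r j = T.dist r i + 1 → P i v →
      G.Adj v w ∧ P j w := by
    by_cases h : T.Adj i j ∧ T.dist r j = T.dist r i + 1 ∧ P i v
    · obtain ⟨w, hw⟩ := hP i j v h.1 h.2.1 h.2.2
      exact ⟨w, fun _ _ _ => hw⟩
    · exact ⟨v, fun hij hdist hv => absurd ⟨hij, hdist, hv⟩ h⟩
  choose step hstep using hstep
  obtain ⟨φ, hφr, hφ⟩ := exists_tree_recursion hT r v₀ step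
  have hinv (n : ℕ) : ∀ i, T.dist r i = n → P i (φ i) := by
    induction n with
    | zero =>
      intro i hi
      rwa [← hT.connected.dist_eq_zero_iff.mp hi, hφr]
    | succ n ih =>
      intro j hj
      obtain ⟨i, hij, hdist⟩ := exists_adj_dist_eq_add_one hT.connected (r := r) (j := j) <| by
        rintro rfl
        simp at hj
      rw [hφ i j hij hdist]
      exact (hstep i j (φ i) hij hdist (ih i (by lia))).2
  have hadj (i j : W) (hij : T.Adj i j) (hdist : T.dist r j = T.dist r i + 1) :
      G.Adj (φ i) (φ j) := by
    rw [hφ i j hij hdist]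
    exact (hstep i j (φ i) hij hdist (hinv _ i rfl)).1
  exact ⟨⟨φ, fun {i j} hij => (hT.dist_eq_dist_add_one_of_adj r hij).elim
    (fun h => (hadj j i hij.symm h).symm) (hadj i j hij)⟩, fun i => hinv _ i rfl⟩

theorem exists_hom_of_extends_card [Fintype W] (hT : T.IsTree) {P : ℕ → W → V → Prop} {r : W}
    {v₀ : V} (hr : P (Fintype.card W) r v₀)
    (hP : ∀ s i j v, T.Adj i j → P (s + 1) i v → ∃ w, G.Adj v w ∧ P s j w) :
    ∃ φ : T →g G, ∀ i, ∃ s, P (s + 1) i (φ i) := by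
  have hlt (i : W) : T.dist r i < Fintype.card W := by
    obtain ⟨p, hp, hlen⟩ := hT.connected.exists_path_of_dist r i
    exact hlen ▸ hp.length_lt
  obtain ⟨φ, hφ⟩ := exists_hom_of_extends (G := G) (r := r) (v₀ := v₀) hT
    (P := fun i v => P (Fintype.card W - T.dist r i) i v) (by simpa using hr)
    fun i j v hij hdist hv => hP _ i j v hij <| by
      rwa [hdist, show Fintype.card W - (T.dist r i + 1) + 1 = Fintype.card W - T.dist r i by
        have := hlt j
        lia]
  refine ⟨φ, fun i => ⟨Fintype.card W - T.dist r i - 1, ?_⟩⟩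
  rw [Nat.sub_add_cancel (Nat.sub_pos_of_lt (hlt i))]
  exact hφ i

end TreeHom

section ArcConsistency

variable {V W : Type*} {G : SimpleGraph V} {T : SimpleGraph W} {out : V → Set V}
  {χ : V → Option W}

/-- The vertices that survive `s` rounds of arc consistency for the partial colouring `χ`: a vertex
of colour `i` survives a round if no vertex of `out v` has a colour outside `N(i)` and every colour
in `N(i)` occurs among its neighbours that survived the previous round. -/
def survivors (G : SimpleGraph V) (T : SimpleGraph W) (out : V → Set V) (χ : V → Option W) :
    ℕ → Set V
  | 0 => Set.univ
  | s + 1 => {v | ∃ i, χ v = some i ∧ (∀ w ∈ out v, ∀ j, χ w = some j → T.Adj i j) ∧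
      ∀ j, T.Adj i j → ∃ w, G.Adj v w ∧ χ w = some j ∧ w ∈ survivors G T out χ s}

theorem nonempty_embedding_of_mem_survivors [Fintype W] (hT : T.IsTree)
    (hout : ∀ u v, G.Adj u v → v ∈ out u ∨ u ∈ out v) {v : V}
    (hv : v ∈ survivors G T out χ (Fintype.card W)) : Nonempty (T ↪g G) := by
  have := hT.connected.nonempty
  obtain ⟨r, hr⟩ : ∃ r, χ v = some r := by
    rw [← Nat.sub_add_cancel (Fintype.card_pos (α := W))] at hv
    exact hv.imp fun _ h => h.1
  obtain ⟨φ, hφ⟩ := exists_hom_of_extends_card (G := G) hT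
    (P := fun s i v => χ v = some i ∧ v ∈ survivors G T out χ s) ⟨hr, hv⟩ <| by
      rintro s i j v hij ⟨hi, i', hi', -, hnbr⟩
      obtain rfl : i = i' := Option.some_injective _ (hi.symm.trans hi')
      exact hnbr j hij
  have hcolor (i : W) : χ (φ i) = some i := (hφ i).choose_spec.1
  have hadj_of_out (i j : W) (hij : φ j ∈ out (φ i)) : T.Adj i j := by
    obtain ⟨s, -, i', hi', hind, -⟩ := hφ i
    obtain rfl : i = i' := Option.some_injective _ ((hcolor i).symm.trans hi')
    exact hind _ hij j (hcolor j)
  have hinj : Function.Injective φ := fun i j hij =>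
    Option.some_injective _ <| by rw [← hcolor i, ← hcolor j, hij]
  exact ⟨⟨⟨φ, hinj⟩, fun {i j} => ⟨fun hij => (hout _ _ hij).elim (hadj_of_out i j)
    fun h => (hadj_of_out j i h).symm, φ.map_adj⟩⟩⟩

theorem mem_survivors_of_embedding (φ : T ↪g G) (hout : ∀ v, out v ⊆ G.neighborSet v)
    (hχ : ∀ i, Set.EqOn χ (Function.partialInv φ) (insert (φ i) (out (φ i)))) (s : ℕ) (i : W) :
    φ i ∈ survivors G T out χ s := by
  have hcolor (i : W) : χ (φ i) = some i :=
    (hχ i (Set.mem_insert _ _)).trans (Function.partialInv_left φ.injective i)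
  induction s generalizing i with
  | zero => trivial
  | succ s ih =>
    refine ⟨i, hcolor i, fun w hw j hj => ?_,
      fun j hij => ⟨φ j, φ.map_adj_iff.mpr hij, hcolor j, ih j⟩⟩
    obtain rfl : φ j = w := (φ.injective.isPartialInv j w).mp <|
      (hχ i (Set.mem_insert_of_mem _ hw)).symm.trans hj
    exact φ.map_adj_iff.mp (hout _ hw)

end ArcConsistency

section BroadcastProtocol

theorem exists_injective_length_eq_clog (α : Type*) [Finite α] :
    ∃ e : α → List Bool, Function.Injective e ∧ ∀ a, (e a).length = Nat.clog 2 (Nat.card α) := by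
  have := Fintype.ofFinite α
  obtain ⟨e⟩ := Function.Embedding.nonempty_of_card_le (α := α)
    (β := Fin (Nat.clog 2 (Nat.card α)) → Bool) <| by
      simpa using Nat.le_pow_clog one_lt_two (Fintype.card α)
  exact ⟨fun a => List.ofFn (e a), List.ofFn_injective.comp e.injective, fun a => by simp⟩

/-- A fixed-length binary code for the elements of a finite type. -/
noncomputable def bitEncoding (α : Type*) [Finite α] : α → List Bool :=
  (exists_injective_length_eq_clog α).choose

theorem bitEncoding_injective (α : Type*) [Finite α] : Function.Injective (bitEncoding α) :=
  (exists_injective_length_eq_clog α).choose_spec.1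

theorem length_bitEncoding {α : Type*} [Finite α] (a : α) :
    (bitEncoding α a).length = Nat.clog 2 (Nat.card α) :=
  (exists_injective_length_eq_clog α).choose_spec.2 a

/-- A protocol for networks with identifiers in `Fin N` that abstracts from ports and bits: in each
round every node broadcasts its identifier and a message from a finite set to all its neighbours,
and updates its state according to the round number, its identifier and the set of pairs received.
After a fixed number of rounds it accepts or rejects. -/
structure BroadcastProtocol (N : ℕ) where
  State : Type
  Msg : Type
  [finite_msg : Finite Msg]
  init : State
  send : ℕ → State → Msg
  recv : ℕ → Fin N → State → Set (Fin N × Msg) → State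
  rounds : ℕ
  accept : State → Prop

namespace BroadcastProtocol

attribute [instance] finite_msg

variable {V W : Type*} {G : SimpleGraph V} {H : SimpleGraph W} {N : ℕ}

/-- The state of each node after `t` rounds of the protocol. -/
def run (P : BroadcastProtocol N) (net : Network G N) : ℕ → V → P.State
  | 0, _ => P.init
  | t + 1, v => P.recv t (net.ident v) (P.run net t v)
      ((fun w => (net.ident w, P.send t (P.run net t w))) '' G.neighborSet v)

/-- The state of a node that executes a broadcast protocol as an `Algorithm`: the data of the
protocol together with the parameters of the node and the round number. -/
structure ClockedState (P : ∀ N, BroadcastProtocol N) where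
  N : ℕ
  ident : Fin N
  time : ℕ
  data : (P N).State

open scoped Classical in
/-- The implementation of a family of broadcast protocols in the port-numbered message-passing
model. The state is frozen once the protocol has ended. -/
noncomputable def toAlgorithm (P : ∀ N, BroadcastProtocol N) : Algorithm where
  State := ClockedState P
  init N i _ := ⟨N, i, 0, (P N).init⟩
  send _ s _ := bitEncoding (Fin s.N × (P s.N).Msg) (s.ident, (P s.N).send s.time s.data)
  recv _ s m := if s.time < (P s.N).rounds then
    ⟨s.N, s.ident, s.time + 1, (P s.N).recv s.time s.ident s.data (bitEncoding _ ⁻¹' Set.range m)⟩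
    else s
  out s := if (P s.N).rounds ≤ s.time then some (decide ((P s.N).accept s.data)) else none
  out_recv δ s m y hy := by
    by_cases h : s.time < (P s.N).rounds
    · simp [h.not_ge] at hy
    · rwa [if_neg h]

variable {P : ∀ N, BroadcastProtocol N} (net : Network G N)

theorem state_toAlgorithm {t : ℕ} (ht : t ≤ (P N).rounds) (v : V) :
    net.state (toAlgorithm P) t v = ⟨N, net.ident v, t, (P N).run net t v⟩ := by
  induction t generalizing v with
  | zero => rfl
  | succ t ih =>
    have hinbox : bitEncoding (Fin N × (P N).Msg) ⁻¹' Set.range (fun p : Fin (net.deg v) =>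
        bitEncoding _ (net.ident (net.nbr v p), (P N).send t ((P N).run net t (net.nbr v p)))) =
        (fun w => (net.ident w, (P N).send t ((P N).run net t w))) '' G.neighborSet v := by
      ext x
      simp only [Set.mem_preimage, Set.mem_range, (bitEncoding_injective _).eq_iff, Set.mem_image]
      exact ⟨fun ⟨p, hp⟩ => ⟨_, (net.port v p).2, hp⟩, fun ⟨w, hw, hx⟩ =>
        ⟨(net.port v).symm ⟨w, hw⟩, by simpa [Network.nbr] using hx⟩⟩
    simp only [Network.state, ih (Nat.le_of_succ_le ht), run, ← hinbox]
    exact if_pos ht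

theorem detectsInduced_toAlgorithm
    (hcomplete : ∀ (φ : H ↪g G) i, (P N).accept ((P N).run net (P N).rounds (φ i)))
    (hsound : ∀ v, (P N).accept ((P N).run net (P N).rounds v) → Nonempty (H ↪g G)) :
    DetectsInduced (toAlgorithm P) net H (Nat.clog 2 (Nat.card (Fin N × (P N).Msg)))
      (P N).rounds := by
  classical
  refine ⟨fun t ht v p => ?_, fun v => decide ((P N).accept ((P N).run net (P N).rounds v)),
    fun v => ?_, ?_, ?_⟩
  · simp only [Network.message, state_toAlgorithm net ht.le]
    exact (length_bitEncoding _).le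
  · rw [state_toAlgorithm net le_rfl]
    simp [toAlgorithm]
  · rintro _ ⟨φ, i, rfl⟩
    exact decide_eq_true (hcomplete φ i)
  · exact fun ⟨v, hv⟩ => hsound v (of_decide_eq_true hv)

end BroadcastProtocol

theorem DetectsInduced.mono {V W : Type*} {G : SimpleGraph V} {H : SimpleGraph W} {N : ℕ}
    {A : Algorithm} {net : Network G N} {B B' R : ℕ} (h : DetectsInduced A net H B R)
    (hB : ∀ u v, G.Adj u v → B ≤ B') : DetectsInduced A net H B' R :=
  ⟨fun t ht v p => (h.1 t ht v p).trans (hB _ _ (net.port v p).2), h.2⟩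

end BroadcastProtocol

section TreeDetection

variable {V W : Type*} {G : SimpleGraph V} {T : SimpleGraph W} {N g w : ℕ}

/-- The state of a node in the tree detection protocol: whether it is still to be peeled, the
neighbours that were peeled before it, and the colourings for which it survives. -/
structure NodeState (N g w : ℕ) where
  active : Prop
  earlier : Set (Fin N)
  alive : Set (Fin g × Fin w)

/-- The messages of the tree detection protocol: whether the sender is still to be peeled, and for
which colourings of the current chunk it survives. -/
abbrev NodeMsg (w : ℕ) : Type := Prop × Set (Fin w)

/-- A round of peeling. -/
def peelStep (D : ℕ) (s : NodeState N g w) (inbox : Set (Fin N × NodeMsg w)) :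
    NodeState N g w where
  active := s.active ∧ D < {y | ∃ x ∈ inbox, x.1 = y ∧ x.2.1}.ncard
  earlier := s.earlier ∪ {y | s.active ∧ ∃ x ∈ inbox, x.1 = y ∧ ¬ x.2.1}
  alive := s.alive

/-- A round of arc consistency for all colourings of chunk `a`, at the node `me`. -/
def filterStep (T : SimpleGraph W) (F : Fin g × Fin w → Fin N → Option W) (a : ℕ) (me : Fin N)
    (s : NodeState N g w) (inbox : Set (Fin N × NodeMsg w)) : NodeState N g w where
  active := s.active
  earlier := s.earlier
  alive := {c | if (c.1 : ℕ) = a then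
    ∃ i, F c me = some i ∧
      (∀ x ∈ inbox, x.1 ∉ s.earlier → ∀ j, F c x.1 = some j → T.Adj i j) ∧
      ∀ j, T.Adj i j → ∃ x ∈ inbox, F c x.1 = some j ∧ c.2 ∈ x.2.2
    else c ∈ s.alive}

/-- The tree detection protocol: `p` rounds of peeling, after which every node knows its
out-neighbours, followed by `|W|` rounds of arc consistency for each of the `g` chunks of `w`
colourings in the family `F`. -/
def treeDetection [Fintype W] (T : SimpleGraph W) (D p : ℕ)
    (F : Fin g × Fin w → Fin N → Option W) : BroadcastProtocol N where
  State := NodeState N g w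
  Msg := NodeMsg w
  init := ⟨True, ∅, Set.univ⟩
  send t s := (s.active, {i | ∃ a : Fin g, (a : ℕ) = (t - p) / Fintype.card W ∧ (a, i) ∈ s.alive})
  recv t me s inbox :=
    if t < p then peelStep D s inbox else filterStep T F ((t - p) / Fintype.card W) me s inbox
  rounds := p + g * Fintype.card W
  accept s := s.alive.Nonempty

theorem peelStep_peel (ident : V ↪ Fin N) (D t : ℕ) (v : V) (alive : Set (Fin g × Fin w))
    (m : V → Set (Fin w)) :
    peelStep D ⟨v ∈ peel G D t, ident '' (G.neighborSet v \ outNbrs G D t v), alive⟩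
        ((fun u => (ident u, (u ∈ peel G D t, m u))) '' G.neighborSet v) =
      ⟨v ∈ peel G D (t + 1), ident '' (G.neighborSet v \ outNbrs G D (t + 1) v), alive⟩ := by
  have hactive : {y | ∃ u, G.Adj v u ∧ ident u = y ∧ u ∈ peel G D t} =
      ident '' (G.neighborSet v ∩ peel G D t) := by
    ext y
    aesop
  rw [neighborSet_diff_outNbrs_succ, Set.image_union]
  simp only [peelStep, Set.exists_mem_image, SimpleGraph.mem_neighborSet, hactive,
    Set.ncard_image_of_injective _ ident.injective, peel, Set.mem_ofPred_eq]
  congr 1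
  ext y
  aesop

theorem filterStep_survivors (ident : V ↪ Fin N) {F : Fin g × Fin w → Fin N → Option W}
    {out : V → Set V} {v : V} (hout : out v ⊆ G.neighborSet v) (a : ℕ) (s : Fin g × Fin w → ℕ)
    (active : V → Prop) :
    filterStep T F a (ident v) ⟨active v, ident '' (G.neighborSet v \ out v),
        {c | v ∈ survivors G T out (F c ∘ ident) (s c)}⟩
        ((fun u => (ident u, (active u, {i | ∃ b : Fin g, (b : ℕ) = a ∧
          u ∈ survivors G T out (F (b, i) ∘ ident) (s (b, i))}))) '' G.neighborSet v) =
      ⟨active v, ident '' (G.neighborSet v \ out v), {c | v ∈ survivors G T out (F c ∘ ident)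
        (s c + if (c.1 : ℕ) = a then 1 else 0)}⟩ := by
  have hforall (Q : V → Prop) : (∀ u, G.Adj v u →
      ident u ∉ ident '' (G.neighborSet v \ out v) → Q u) ↔ ∀ u ∈ out v, Q u := by
    simp only [ident.injective.mem_set_image, Set.mem_sdiff, SimpleGraph.mem_neighborSet]
    exact ⟨fun h u hu => h u (hout hu) (by simp [hu]), fun h u huv hu => h u (by tauto)⟩
  simp only [filterStep, NodeState.mk.injEq, true_and, Set.forall_mem_image, Set.exists_mem_image,
    SimpleGraph.mem_neighborSet, hforall]
  ext c
  by_cases hc : (c.1 : ℕ) = a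
  · subst hc
    simp [survivors, Fin.val_inj]
  · simp [hc]

variable [Fintype W] {D p : ℕ} {F : Fin g × Fin w → Fin N → Option W} (net : Network G N)

theorem run_treeDetection_of_le {t : ℕ} (ht : t ≤ p) (v : V) :
    (treeDetection T D p F).run net t v =
      ⟨v ∈ peel G D t, net.ident '' (G.neighborSet v \ outNbrs G D t v), Set.univ⟩ := by
  induction t generalizing v with
  | zero =>
    have : G.neighborSet v \ outNbrs G D 0 v = ∅ := by simp [outNbrs, SimpleGraph.neighborSet]
    simp [BroadcastProtocol.run, treeDetection, peel, this]
  | succ t ih =>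
    rw [BroadcastProtocol.run]
    simp only [ih (Nat.le_of_succ_le ht)]
    exact (if_pos ht).trans (peelStep_peel _ _ _ _ _ _)

/- Chunk `a` is treated in the rounds `a * k, …, a * k + k - 1`, so `min k (τ - a * k)` of the
first `τ` rounds belong to it. -/
theorem min_succ_sub_mul {k : ℕ} (hk : 0 < k) (a τ : ℕ) :
    min k (τ + 1 - a * k) = min k (τ - a * k) + if a = τ / k then 1 else 0 := by
  split_ifs with h
  · obtain ⟨hle, hlt⟩ := (Nat.div_eq_iff hk).mp h.symm
    lia
  · rcases lt_or_gt_of_ne h with h | h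
    · have := (Nat.le_div_iff_mul_le hk).mp h
      rw [Nat.succ_mul] at this
      lia
    · have := (Nat.div_lt_iff_lt_mul hk).mp h
      lia

theorem run_treeDetection_add [Nonempty W] (τ : ℕ) (v : V) :
    (treeDetection T D p F).run net (p + τ) v =
      ⟨v ∈ peel G D p, net.ident '' (G.neighborSet v \ outNbrs G D p v),
        {c | v ∈ survivors G T (outNbrs G D p) (F c ∘ net.ident)
          (min (Fintype.card W) (τ - c.1 * Fintype.card W))}⟩ := by
  induction τ generalizing v with
  | zero =>
    simp only [add_zero, run_treeDetection_of_le net le_rfl, Nat.zero_sub, Nat.min_zero, survivors,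
      Set.mem_univ]
    rfl
  | succ τ ih =>
    rw [← add_assoc, BroadcastProtocol.run]
    simp only [ih, min_succ_sub_mul Fintype.card_pos]
    refine (if_neg (by lia)).trans ?_
    simp only [treeDetection, Nat.add_sub_cancel_left]
    exact filterStep_survivors net.ident (outNbrs_subset D p v) _ _ (· ∈ peel G D p)

theorem accept_run_treeDetection_iff [Nonempty W] (v : V) :
    (treeDetection T D p F).accept
        ((treeDetection T D p F).run net (treeDetection T D p F).rounds v) ↔
      ∃ c, v ∈ survivors G T (outNbrs G D p) (F c ∘ net.ident) (Fintype.card W) := by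
  have hmin (c : Fin g × Fin w) :
      min (Fintype.card W) (g * Fintype.card W - c.1 * Fintype.card W) = Fintype.card W := by
    rw [← Nat.sub_mul, min_eq_left]
    exact Nat.le_mul_of_pos_left _ (Nat.sub_pos_of_lt c.1.isLt)
  have hrun := run_treeDetection_add (T := T) (D := D) (p := p) (F := F) net (g * Fintype.card W) v
  simp only [hmin] at hrun
  exact iff_of_eq (congrArg (fun s => s.alive.Nonempty) hrun)

theorem nonempty_embedding_of_accept_run_treeDetection (hT : T.IsTree) {v : V}
    (hv : (treeDetection T D p F).accept
      ((treeDetection T D p F).run net (treeDetection T D p F).rounds v)) :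
    Nonempty (T ↪g G) := by
  have := hT.connected.nonempty
  obtain ⟨c, hc⟩ := (accept_run_treeDetection_iff net v).mp hv
  exact nonempty_embedding_of_mem_survivors hT (fun _ _ => mem_outNbrs_or_mem_outNbrs D p) hc

theorem ncard_iUnion_insert_outNbrs_le [Finite V] (hp : peel G D p = ∅) (φ : W → V) :
    (⋃ i, insert (φ i) (outNbrs G D p (φ i))).ncard ≤ Fintype.card W * (D + 1) := calc
  _ ≤ ∑ i, (insert (φ i) (outNbrs G D p (φ i))).ncard := by
    simpa using Finset.set_ncard_biUnion_le Finset.univ fun i => insert (φ i) (outNbrs G D p (φ i))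
  _ ≤ ∑ _ : W, (D + 1) := Finset.sum_le_sum fun i _ => (Set.ncard_insert_le _ _).trans <|
    Nat.succ_le_succ <| ncard_outNbrs_le (by simp [hp])
  _ = Fintype.card W * (D + 1) := by simp

theorem accept_run_treeDetection_of_embedding [Nonempty W] (hp : peel G D p = ∅)
    (hF : IsUniversal F (Fintype.card W * (D + 1))) (φ : T ↪g G) (i : W) :
    (treeDetection T D p F).accept
      ((treeDetection T D p F).run net (treeDetection T D p F).rounds (φ i)) := by
  have : Finite V := .of_injective _ net.ident.injective
  have : Nonempty V := ⟨φ i⟩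
  obtain ⟨c, hc⟩ := (hF.comp_injective net.ident.injective).exists_eqOn (Function.partialInv φ)
    (ncard_iUnion_insert_outNbrs_le hp φ)
  exact (accept_run_treeDetection_iff net _).mpr ⟨c, mem_survivors_of_embedding φ
    (outNbrs_subset D p) (fun j => hc.mono (Set.subset_iUnion_of_subset j subset_rfl)) _ i⟩

theorem clog_card_treeDetection_msg_le {N L : ℕ} (hN : N ≤ 2 ^ L) :
    Nat.clog 2 (Nat.card (Fin N × NodeMsg (L + 1))) ≤ 2 * L + 2 := by
  apply Nat.clog_le_of_le_pow
  have hcard : Nat.card (Fin N × NodeMsg (L + 1)) = N * (2 * 2 ^ (L + 1)) := by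
    simp
  calc _ = N * 2 ^ (L + 2) := by rw [hcard]; ring
    _ ≤ 2 ^ L * 2 ^ (L + 2) := by gcongr
    _ = 2 ^ (2 * L + 2) := by ring

/-- The number of chunks of colourings that suffices for trees on `k` nodes and out-degrees
`≤ 4 * d`. -/
def numChunks (d k : ℕ) : ℕ :=
  (k + 1) ^ (k * (4 * d + 1)) * (k * (4 * d + 1) * (k + 1) + 1)

theorem exists_isUniversal_colorings (d k : ℕ) {N L : ℕ} (hN : N ≤ 2 ^ L) :
    ∃ F : Fin (numChunks d k) × Fin (L + 1) → Fin N → Option (Fin k),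
      IsUniversal F (k * (4 * d + 1)) :=
  exists_isUniversal_prod (by simpa using hN) (by simp) _

end TreeDetection

theorem clog_le_mul_clog_of_le_pow {N n c : ℕ} (h : N ≤ n ^ c) :
    Nat.clog 2 N ≤ c * Nat.clog 2 n := by
  apply Nat.clog_le_of_le_pow
  calc N ≤ n ^ c := h
    _ ≤ (2 ^ Nat.clog 2 n) ^ c := Nat.pow_le_pow_left (Nat.le_pow_clog one_lt_two n) c
    _ = 2 ^ (c * Nat.clog 2 n) := by rw [← pow_mul, mul_comm]

end Congest

theorem mainTheorem7_general :
    ∃ f : ℕ → ℕ → ℕ, ∀ (d k : ℕ) (T : SimpleGraph (Fin k)), T.IsTree →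
      ∃ A : Congest.Algorithm,
        ∀ (V : Type*) (G : SimpleGraph V), G.IsDegenerate d →
          ∀ (N : ℕ) (net : Congest.Network G N),
            Congest.DetectsInduced A net T (2 * Nat.clog 2 N + 2) (f d k + Nat.clog 2 N) := by
  refine ⟨fun d k => Congest.numChunks d k * k + 1, fun d k T hT => ?_⟩
  choose F hF using fun N => Congest.exists_isUniversal_colorings d k (Nat.le_pow_clog one_lt_two N)
  let P (N : ℕ) := Congest.treeDetection T (4 * d) (Nat.clog 2 N + 1) (F N)
  refine ⟨Congest.BroadcastProtocol.toAlgorithm P, fun V G hG N net => ?_⟩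
  have : Nonempty (Fin k) := hT.connected.nonempty
  have : Finite V := .of_injective _ net.ident.injective
  have hV : Nat.card V < 2 ^ (Nat.clog 2 N + 1) := calc
    Nat.card V ≤ N := by simpa using Finite.card_le_of_embedding net.ident
    _ ≤ 2 ^ Nat.clog 2 N := Nat.le_pow_clog one_lt_two N
    _ < 2 ^ (Nat.clog 2 N + 1) := Nat.pow_lt_pow_succ one_lt_two
  have hcomplete := Congest.accept_run_treeDetection_of_embedding (T := T) net
    (Congest.peel_eq_empty hG hV) (by simpa using hF N)
  have hdetects := Congest.BroadcastProtocol.detectsInduced_toAlgorithm (P := P) (H := T) net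
    hcomplete fun _ => Congest.nonempty_embedding_of_accept_run_treeDetection net hT
  have hrounds : (P N).rounds = Congest.numChunks d k * k + 1 + Nat.clog 2 N := by
    simp only [P, Congest.treeDetection, Fintype.card_fin]
    ring
  exact hrounds ▸ hdetects.mono fun _ _ _ =>
    Congest.clog_card_treeDetection_msg_le (Nat.le_pow_clog one_lt_two N)

theorem mainTheorem7 :
    ∃ f : ℕ → ℕ → ℕ, ∀ c : ℕ, ∃ b C : ℕ,
      ∀ (d k : ℕ) (T : SimpleGraph (Fin k)), T.IsTree →
        ∃ A : Congest.Algorithm,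
          ∀ (V : Type*) [Fintype V] (G : SimpleGraph V), G.IsDegenerate d →
            ∀ (N : ℕ), N ≤ Fintype.card V ^ c → ∀ net : Congest.Network G N,
              ∃ R : ℕ, R ≤ f d k + C * Nat.clog 2 (Fintype.card V) ∧
                Congest.DetectsInduced A net T (b * Nat.clog 2 (Fintype.card V)) R := by
  obtain ⟨f, hf⟩ := mainTheorem7_general
  refine ⟨f, fun c => ⟨2 * c + 2, c, fun d k T hT => ?_⟩⟩
  obtain ⟨A, hA⟩ := hf d k T hT
  refine ⟨A, fun V _ G hG N hN net => ?_⟩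
  have hlog := Congest.clog_le_mul_clog_of_le_pow hN
  refine ⟨_, Nat.add_le_add_left hlog _, (hA V G hG N net).mono fun u v huv => ?_⟩
  have hpos : 0 < Nat.clog 2 (Fintype.card V) :=
    Nat.clog_pos one_lt_two (Fintype.one_lt_card_iff.mpr ⟨u, v, huv.ne⟩)
  lia
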